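/- Let $\Sigma=\{0,1\}$ and let $\Sigma^\star$ be the set of finite binary strings. For $f:\Sigma^\star\to\Sigma$ let $\bar f(x)=x\circ f(x)$ be the string $x$ with the symbol $f(x)$ appended, and for $T\in\mathbb N$ let $f^{\mathsf{CoT},T}(x)\in\Sigma^T$ be the suffix of length $T$ of $\bar f^{\,T}(x)$, where $\bar f^{\,T}$ is the $T$-fold iterate of $\bar f$. For a class $\mathcal F$ of such functions put $\mathcal F^{\mathsf{CoT},T}=\{f^{\mathsf{CoT},T}: f\in\mathcal F\}$. For $d\in\mathbb N$ let $\mathcal F_{d,\mathrm{lin}}=\{f_{w,b}: w\in\mathbb R^d,\ b\in\mathbb R\}$, where \[ f_{w,b}(x)=\mathbf 1\Big[\sum_{i=1}^{\min\{d,|x|\}} w[-i]\,x[-i]+b\ge 0\Big] \] and $[-i]$ denotes the $i$-th entry from the end. A class $\mathcal H$ of functions $\mathcal X\to\mathcal Y$ is called learnable with sample complexity $m(\varepsilon,\delta)\in\mathbb N$ if there is a learning rule $\mathsf{Lrn}:(\mathcal X\times\mathcal Y)^\star\to\mathcal Y^{\mathcal X}$ such that for every probability distribution $D$ on $\mathcal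 X$, all $\varepsilon,\delta>0$ and every $h\in\mathcal H$, if $x_1,\dots,x_m$ are drawn i.i.d. from $D$ with $m=m(\varepsilon,\delta)$ and $\hat h=\mathsf{Lrn}((x_1,h(x_1)),\dots,(x_m,h(x_m)))$, then $\Pr_{x\sim D}[\hat h(x)\ne h(x)]>\varepsilon$ holds with probability at most $\delta$. Theorem. (1) There is a universal constant $C>0$ such that for all $d,T\in\mathbb N$ (including $0$) the class $\mathcal F_{d,\mathrm{lin}}^{\mathsf{CoT},T}$ is learnable with sample complexity \[ m(\varepsilon,\delta)=\max\Big\{0,\Big\lceil C\,\frac{d+\log(1/\delta)}{\varepsilon}\Big\rceil\Big\}. \] (2) This is optimal up to universal constants: there is a universal constant $c>0$ such that for all $d,T\ge 1$, if $\mathcal F_{d,\mathrm{lin}}^{\mathsf{CoT},T}$ is learnable with sample complexity $m(\varepsilon,\delta)$, then \[ m(\varepsilon,\delta)\ \ge\ c\,\frac{d+\log(1/\delta)}{\varepsilon}\qquad\text{for all } 0<\varepsilon\le\tfrac18,\ 0<\delta\le\tfrac18 . \] -/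

import Mathlib

open MeasureTheory

namespace Autoregressive

/-- Finite binary strings carry the discrete σ-algebra. -/
instance instMeasurableSpaceWord : MeasurableSpace (List Bool) := ⊤

instance instDiscreteMeasurableSpaceWord : DiscreteMeasurableSpace (List Bool) :=
  ⟨fun _ => trivial⟩

/-- The apply-and-append map of a next-token generator `f`: it sends `x` to `x` followed by
the symbol `f x`. -/
def applyAppend (f : List Bool → Bool) (x : List Bool) : List Bool := x ++ [f x]

theorem length_iterate_applyAppend (f : List Bool → Bool) (T : ℕ) (x : List Bool) :
    ((applyAppend f)^[T] x).length = x.length + T := by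
  induction T generalizing x with
  | zero => simp
  | succ n ih =>
    rw [Function.iterate_succ_apply, ih]
    simp [applyAppend]
    omega

/-- The `T`-step chain of thought of `f` on `x`: the suffix of length `T` of the string obtained
from `x` by applying the apply-and-append map `T` times. -/
def cot (f : List Bool → Bool) (T : ℕ) (x : List Bool) : Fin T → Bool :=
  fun t => ((applyAppend f)^[T] x)[x.length + (t : ℕ)]'(by
    rw [length_iterate_applyAppend]; omega)

/-- The chain-of-thought class induced by a base class `F` of next-token generators. -/
def cotClass (F : Set (List Bool → Bool)) (T : ℕ) : Set (List Bool → (Fin T → Bool)) :=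
  {g | ∃ f ∈ F, g = cot f T}

open Classical in
/-- The linear threshold generator with weights `w` and bias `b`, acting on the last `d` bits of
the input: bit number `i + 1` from the end of `x` is multiplied by entry number `i + 1` from the
end of `w`, for all `i < min d |x|`. -/
noncomputable def linGenerator {d : ℕ} (w : Fin d → ℝ) (b : ℝ) (x : List Bool) : Bool :=
  decide (0 ≤ (∑ i : Fin (min d x.length),
    w (Fin.rev (Fin.castLE (min_le_left d x.length) i)) *
      (if x.get (Fin.rev (Fin.castLE (min_le_right d x.length) i)) then (1 : ℝ) else 0)) + b)

/-- The class of all linear threshold generators acting on the last `d` bits. -/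
def linClass (d : ℕ) : Set (List Bool → Bool) :=
  {f | ∃ (w : Fin d → ℝ) (b : ℝ), f = linGenerator w b}

/-- The sample `(x₁, f x₁), …, (xₘ, f xₘ)`. -/
def labeledSample {X Y : Type*} (f : X → Y) {m : ℕ} (x : Fin m → X) : List (X × Y) :=
  List.ofFn fun i => (x i, f (x i))

/-- The population loss of the predictor `h` with respect to the target `f`. -/
noncomputable def loss {X Y : Type*} [MeasurableSpace X] (D : Measure X) (f h : X → Y) : ENNReal :=
  D {x | h x ≠ f x}

/-- `H` is (realizably) PAC-learnable with sample complexity `m`: one learning rule, which knows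
neither the distribution nor the target nor `ε` and `δ`, has loss greater than `ε` with
probability at most `δ` on an i.i.d. sample of size `m ε δ` labeled by any target in `H`. -/
def LearnableWith {X Y : Type*} [MeasurableSpace X] (H : Set (X → Y)) (m : ℝ → ℝ → ℕ) : Prop :=
  ∃ lrn : List (X × Y) → (X → Y),
    ∀ (D : Measure X) [IsProbabilityMeasure D] (ε δ : ℝ), 0 < ε → 0 < δ → ∀ f ∈ H,
      Measure.pi (fun _ : Fin (m ε δ) => D)
        {x | ENNReal.ofReal ε < loss D f (lrn (labeledSample f x))} ≤ ENNReal.ofReal δ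

end Autoregressive

/-! Upper bound. A labeled example shows the whole chain of thought, so every prefix on which a
token was predicted is known, and consistency with the example is a system of linear inequalities in
the weights and the bias. With margin `1` it cuts out a closed convex set in dimension `d + 1`,
whatever `T` is. The learner takes the point of minimal norm in the intersection of these sets. By
Helly's theorem (`exists_minNormPoint_eq`) at most `d + 1` examples determine this point, and
dropping any others does not move it. Such a stable compression scheme has a generalization bound
without logarithmic factor (`measure_lt_loss_le_of_stable`), since a union bound over blocks of
examples replaces one over subsets of the sample.

Lower bound. `LearnableWith.log_le` gives `log (1 / δ) / ε` from two targets that a rare point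
separates; `LearnableWith.card_le` gives `N / ε` from `N` shattered points. Disjunctions of bits
supply both configurations. They are chosen so that only the first token carries information: the
later tokens, which the learner also sees, are constant. -/

namespace Autoregressive

/-! ### Generalization from stable compression -/

section Compression

variable {X Y : Type*} [MeasurableSpace X] [DiscreteMeasurableSpace X] [Countable X]

/-- A hypothesis that is computed from the sample points satisfying `p` is unlikely to have a large
loss and still to be consistent with all the remaining sample points. -/
theorem measure_lt_loss_and_consistent_le (μ : Measure X) [IsProbabilityMeasure μ] (f : X → Y)
    {ι : Type*} [Fintype ι] (p : ι → Prop) [DecidablePred p]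
    (h : ({i // p i} → X) → X → Y) (ε : ℝ) :
    Measure.pi (fun _ : ι => μ)
      {x | ENNReal.ofReal ε < loss μ f (h fun i => x i) ∧
        ∀ i, ¬ p i → h (fun i => x i) (x i) = f (x i)} ≤
      ENNReal.ofReal (1 - ε) ^ Fintype.card {i // ¬ p i} := by
  -- Fubini: once the coordinates in `p` are fixed, so is the hypothesis, and the remaining points
  -- are independent of it. Each is classified correctly with probability below `1 - ε`.
  set S : Set (({i // p i} → X) × ({i // ¬ p i} → X)) :=
    {z | ENNReal.ofReal ε < loss μ f (h z.1) ∧ ∀ i, h z.1 (z.2 i) = f (z.2 i)} with hS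
  have hSm : MeasurableSet S := MeasurableSet.of_discrete
  have hmp := measurePreserving_piEquivPiSubtypeProd (fun _ : ι => μ) p
  have hpre : {x : ι → X | ENNReal.ofReal ε < loss μ f (h fun i => x i) ∧
      ∀ i, ¬ p i → h (fun i => x i) (x i) = f (x i)} =
      MeasurableEquiv.piEquivPiSubtypeProd (fun _ : ι => X) p ⁻¹' S := by
    ext x
    simp [hS, MeasurableEquiv.piEquivPiSubtypeProd, Equiv.piEquivPiSubtypeProd]
  rw [hpre, hmp.measure_preimage hSm.nullMeasurableSet, Measure.prod_apply hSm]
  calc _ ≤ ∫⁻ _ : {i // p i} → X, ENNReal.ofReal (1 - ε) ^ Fintype.card {i // ¬ p i}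
        ∂(Measure.pi fun _ => μ) := by
        refine lintegral_mono fun z => ?_
        by_cases hz : ENNReal.ofReal ε < loss μ f (h z)
        · have hsub : Prod.mk z ⁻¹' S = Set.univ.pi fun _ => {x | h z x = f x} := by
            ext y
            simp [hS, hz]
          rw [hsub, Measure.pi_pi, Finset.prod_const, Finset.card_univ]
          gcongr
          have hc : {x | h z x = f x} = {x | h z x ≠ f x}ᶜ := by
            ext x; simp
          rw [hc, prob_compl_eq_one_sub MeasurableSet.of_discrete, ← ENNReal.ofReal_one]
          refine le_trans (tsub_le_tsub_left hz.le _) ?_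
          rcases le_total 0 ε with h0 | h0
          · rw [ENNReal.ofReal_sub _ h0]
          · rw [ENNReal.ofReal_of_nonpos h0, tsub_zero]
            exact ENNReal.ofReal_le_ofReal (by linarith)
        · have hsub : Prod.mk z ⁻¹' S = ∅ := by
            ext y
            simp [hS, hz]
          simp [hsub]
    _ = _ := by simp

/-- At least `k * (m / n)` of the numbers below `m` have their residue modulo `n` in a given set of
`k` residues. -/
theorem card_mul_div_le_card_mod_mem (m n : ℕ) [NeZero n] (B : Finset (Fin n)) :
    B.card * (m / n) ≤ Fintype.card {i : Fin m // Fin.ofNat n i ∈ B} := by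
  have hle : m / n * n ≤ m := Nat.div_mul_le_self m n
  have hcard : Fintype.card (Fin (m / n) × B) = B.card * (m / n) := by
    simp [mul_comm]
  rw [← hcard]
  refine Fintype.card_le_of_injective
    (fun z => ⟨Fin.castLE hle (finProdFinEquiv (z.1, z.2.1)), ?_⟩) ?_
  · have : Fin.ofNat n (Fin.castLE hle (finProdFinEquiv (z.1, z.2.1)) : ℕ) = z.2.1 := by
      ext
      simp [Nat.mod_eq_of_lt]
    rw [this]
    exact z.2.2
  · rintro ⟨a, b⟩ ⟨a', b'⟩ hab
    simp only [Subtype.mk.injEq, (Fin.castLE_injective hle).eq_iff,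
      finProdFinEquiv.injective.eq_iff, Prod.mk.injEq] at hab
    exact Prod.ext hab.1 (Subtype.ext hab.2)

/-- The generalization bound for a stable compression scheme of size `k`. -/
theorem measure_lt_loss_le_of_stable (μ : Measure X) [IsProbabilityMeasure μ] (f : X → Y)
    (A : Set X → X → Y) {k : ℕ} (hk : 0 < k)
    (hcons : ∀ S : Set X, S.Finite → ∀ x ∈ S, A S x = f x)
    (hstab : ∀ S : Set X, S.Finite → ∃ K : Finset X, ↑K ⊆ S ∧ K.card ≤ k ∧
      ∀ S' : Set X, ↑K ⊆ S' → S' ⊆ S → A S' = A S) {ε : ℝ} (hε : 0 ≤ ε) (m : ℕ) :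
    Measure.pi (fun _ : Fin m => μ) {x | ENNReal.ofReal ε < loss μ f (A (Set.range x))} ≤
      4 ^ k * ENNReal.ofReal (1 - ε) ^ (k * (m / (2 * k))) := by
  classical
  have : NeZero (2 * k) := ⟨by omega⟩
  -- The sample is cut into `2 * k` residue blocks. A compression set meets at most `k` of them, so
  -- `k` blocks stay free for testing, at a cost of only `4 ^ k` in the union bound.
  set c : Fin m → Fin (2 * k) := fun i => Fin.ofNat (2 * k) i with hc
  set E : Finset (Fin (2 * k)) → Set (Fin m → X) := fun B =>
    {x | ENNReal.ofReal ε < loss μ f (A (Set.range fun i : {i // c i ∈ B} => x i)) ∧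
      ∀ i, ¬ c i ∈ B → A (Set.range fun i : {i // c i ∈ B} => x i) (x i) = f (x i)} with hE
  have hcover : {x : Fin m → X | ENNReal.ofReal ε < loss μ f (A (Set.range x))} ⊆
      ⋃ B ∈ Finset.univ.powersetCard k, E B := by
    intro x hx
    obtain ⟨K, hKS, hKk, hK⟩ := hstab (Set.range x) (Set.finite_range x)
    choose g hg using fun a : K => hKS a.2
    obtain ⟨B, hB, hBk⟩ := Finset.exists_superset_card_eq (n := k)
      (s := K.attach.image fun a => c (g a)) (Finset.card_image_le.trans (by simpa using hKk)) (by simp; omega)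
    -- Stability enters here: the points in the blocks `B` lie between `K` and the full sample.
    have hA : A (Set.range fun i : {i // c i ∈ B} => x i) = A (Set.range x) := by
      refine hK _ (fun a ha => ?_) (by rintro _ ⟨i, rfl⟩; exact ⟨i, rfl⟩)
      exact ⟨⟨g ⟨a, ha⟩, hB (Finset.mem_image_of_mem _ (Finset.mem_attach _ _))⟩, hg ⟨a, ha⟩⟩
    simp only [Set.mem_iUnion]
    refine ⟨B, by simp [Finset.mem_powersetCard, hBk], ?_⟩
    refine ⟨by rw [hA]; exact hx, fun i _ => ?_⟩
    rw [hA]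
    exact hcons _ (Set.finite_range x) _ ⟨i, rfl⟩
  refine (measure_mono hcover).trans ((measure_biUnion_finset_le _ _).trans ?_)
  have hbound : ∀ B ∈ (Finset.univ : Finset (Fin (2 * k))).powersetCard k,
      Measure.pi (fun _ : Fin m => μ) (E B) ≤ ENNReal.ofReal (1 - ε) ^ (k * (m / (2 * k))) := by
    intro B hB
    refine (measure_lt_loss_and_consistent_le μ f (fun i => c i ∈ B)
      (fun z => A (Set.range z)) ε).trans ?_
    have h1 : ENNReal.ofReal (1 - ε) ≤ 1 := by
      rw [← ENNReal.ofReal_one]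
      exact ENNReal.ofReal_le_ofReal (by linarith)
    refine pow_le_pow_of_le_one zero_le h1 ?_
    have hBc : Bᶜ.card = k := by
      rw [Finset.card_compl, (Finset.mem_powersetCard.1 hB).2, Fintype.card_fin]
      omega
    simpa [hBc, hc] using card_mul_div_le_card_mod_mem m (2 * k) Bᶜ
  refine (Finset.sum_le_sum hbound).trans ?_
  rw [Finset.sum_const, nsmul_eq_mul]
  gcongr
  have : (Finset.powersetCard k (Finset.univ : Finset (Fin (2 * k)))).card ≤ 4 ^ k := by
    rw [Finset.card_powersetCard, Finset.card_univ, Fintype.card_fin]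
    calc _ ≤ 2 ^ (2 * k) := Nat.choose_le_two_pow _ _
      _ = 4 ^ k := by rw [pow_mul]; norm_num
  exact_mod_cast this

end Compression

/-! ### Minimal norm points and Helly's theorem -/

section MinNorm

variable {E : Type*} [NormedAddCommGroup E] [InnerProductSpace ℝ E]

/-- A point of `P` of minimal norm (an arbitrary point if there is none). -/
noncomputable def minNormPoint (P : Set E) : E :=
  Classical.epsilon fun u => u ∈ P ∧ ∀ v ∈ P, ‖u‖ ≤ ‖v‖

theorem minNormPoint_spec [FiniteDimensional ℝ E] {P : Set E} (hne : P.Nonempty)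
    (hcl : IsClosed P) : minNormPoint P ∈ P ∧ ∀ v ∈ P, ‖minNormPoint P‖ ≤ ‖v‖ := by
  refine Classical.epsilon_spec (p := fun u => u ∈ P ∧ ∀ v ∈ P, ‖u‖ ≤ ‖v‖) ?_
  have : ProperSpace E := FiniteDimensional.proper ℝ E
  obtain ⟨u, hu, h⟩ := hcl.exists_infDist_eq_dist hne 0
  refine ⟨u, hu, fun v hv => ?_⟩
  have := Metric.infDist_le_dist_of_mem (x := (0 : E)) hv
  rwa [h, dist_zero_left, dist_zero_left] at this

theorem eq_of_norm_le_of_convex {P : Set E} (hP : Convex ℝ P) {u v : E} (hu : u ∈ P) (hv : v ∈ P)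
    (hu' : ∀ w ∈ P, ‖u‖ ≤ ‖w‖) (hv' : ∀ w ∈ P, ‖v‖ ≤ ‖w‖) : u = v := by
  by_contra hne
  have hn : ‖u‖ = ‖v‖ := le_antisymm (hu' v hv) (hv' u hu)
  have hmid := hP hu hv (by norm_num : (0 : ℝ) ≤ 1 / 2) (by norm_num : (0 : ℝ) ≤ 1 / 2)
    (by norm_num)
  have hlt := norm_combo_lt_of_ne le_rfl hn.ge hne (by norm_num : (0 : ℝ) < 1 / 2)
    (by norm_num : (0 : ℝ) < 1 / 2) (by norm_num)
  exact absurd (hu' _ hmid) (not_le.2 hlt)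

/-- The minimal norm point of an intersection of finitely many convex sets in dimension `n` is
determined by at most `n` of them. -/
theorem exists_minNormPoint_eq [FiniteDimensional ℝ E] {ι : Type*} (C : ι → Set E)
    (hconv : ∀ i, Convex ℝ (C i)) (hcl : ∀ i, IsClosed (C i)) (S : Set ι) (hS : S.Finite)
    (hne : (⋂ i ∈ S, C i).Nonempty) :
    ∃ K : Finset ι, ↑K ⊆ S ∧ K.card ≤ Module.finrank ℝ E ∧
      ∀ S' : Set ι, ↑K ⊆ S' → S' ⊆ S →
        minNormPoint (⋂ i ∈ S', C i) = minNormPoint (⋂ i ∈ S, C i) := by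
  classical
  have hcl' : ∀ S : Set ι, IsClosed (⋂ i ∈ S, C i) := fun S =>
    isClosed_biInter fun i _ => hcl i
  obtain ⟨huS, humin⟩ := minNormPoint_spec hne (hcl' S)
  set u := minNormPoint (⋂ i ∈ S, C i) with hu
  -- The open ball of radius `‖u‖` joins the family as one more convex set. Minimality of `u` makes
  -- the total intersection empty, and Helly leaves `n + 1` sets with empty intersection. The ball
  -- is one of them, as `u` lies in all the others; removing it leaves `n`.
  set F : Option ι → Set E := fun o => o.elim (Metric.ball 0 ‖u‖) C with hF
  have hFconv : ∀ o, Convex ℝ (F o) := by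
    rintro (_ | i)
    · exact convex_ball _ _
    · exact hconv i
  have hempty : ¬ (⋂ o ∈ Finset.insertNone hS.toFinset, F o).Nonempty := by
    rintro ⟨v, hv⟩
    simp only [Set.mem_iInter] at hv
    have h1 := hv none (by simp)
    simp only [hF, Option.elim_none, mem_ball_zero_iff] at h1
    refine absurd (humin v ?_) (not_le.2 h1)
    simp only [Set.mem_iInter]
    intro i hi
    exact hv (some i) (by simpa using hi)
  have hex : ∃ I ⊆ Finset.insertNone hS.toFinset, I.card ≤ Module.finrank ℝ E + 1 ∧
      ¬ (⋂ o ∈ I, F o).Nonempty := by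
    by_contra hcon
    push Not at hcon
    exact hempty (Convex.helly_theorem' (fun o _ => hFconv o) hcon)
  obtain ⟨I, hIS, hIc, hI⟩ := hex
  have hnone : none ∈ I := by
    by_contra hnone
    refine hI ⟨u, ?_⟩
    simp only [Set.mem_iInter] at huS ⊢
    rintro (_ | i) hi
    · exact absurd hi hnone
    · exact huS i (by simpa using hIS hi)
  refine ⟨Finset.eraseNone I, fun i hi => ?_, ?_, fun S' hKS' hS'S => ?_⟩
  · simpa using hIS (Finset.mem_eraseNone.1 hi)
  · have := Finset.card_eraseNone_of_mem hnone
    omega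
  · have hsub : (⋂ i ∈ S, C i) ⊆ ⋂ i ∈ S', C i := Set.biInter_subset_biInter_left hS'S
    obtain ⟨h1, h2⟩ := minNormPoint_spec (hne.mono hsub) (hcl' S')
    refine eq_of_norm_le_of_convex (convex_iInter₂ fun i _ => hconv i) h1 (hsub huS) h2 ?_
    intro w hw
    by_contra hlt
    refine hI ⟨w, ?_⟩
    simp only [Set.mem_iInter] at hw ⊢
    rintro (_ | i) hi
    · simpa [hF] using hlt
    · exact hw i (hKS' (by simpa using hi))

end MinNorm

/-! ### Chains of thought token by token -/

section ChainOfThought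

theorem iterate_applyAppend_prefix (f : List Bool → Bool) (x : List Bool) {a b : ℕ} (h : a ≤ b) :
    (applyAppend f)^[a] x <+: (applyAppend f)^[b] x := by
  induction b, h using Nat.le_induction with
  | base => exact List.prefix_rfl
  | succ b _ ih =>
    rw [Function.iterate_succ_apply']
    exact ih.trans (List.prefix_append _ _)

theorem cot_apply (f : List Bool → Bool) {T : ℕ} (x : List Bool) (t : Fin T) :
    cot f T x t = f ((applyAppend f)^[t] x) := by
  have h := iterate_applyAppend_prefix f x (Nat.succ_le_of_lt t.2)
  unfold cot
  rw [← h.getElem (by rw [length_iterate_applyAppend]; omega)]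
  simp only [Function.iterate_succ_apply', applyAppend]
  rw [List.getElem_append_right (by rw [length_iterate_applyAppend])]
  simp

/-- Being right on each observed prefix is enough: inductively the generator then reproduces these
prefixes on its own. This is what lets the margin constraints be stated on fixed strings. -/
theorem iterate_applyAppend_eq_append_take {f : List Bool → Bool} {T : ℕ} {x : List Bool}
    {y : Fin T → Bool} (h : ∀ t : Fin T, f (x ++ (List.ofFn y).take t) = y t) {t : ℕ} (ht : t ≤ T) :
    (applyAppend f)^[t] x = x ++ (List.ofFn y).take t := by
  induction t with
  | zero => simp
  | succ t ih =>
    rw [Function.iterate_succ_apply', ih (by omega), applyAppend, h ⟨t, ht⟩,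
      List.take_add_one, List.append_assoc]
    simp [Nat.lt_of_succ_le ht]

theorem cot_eq_of_forall {f : List Bool → Bool} {T : ℕ} {x : List Bool} {y : Fin T → Bool}
    (h : ∀ t : Fin T, f (x ++ (List.ofFn y).take t) = y t) : cot f T x = y := by
  funext t
  rw [cot_apply, iterate_applyAppend_eq_append_take h t.2.le, h]

theorem iterate_applyAppend_eq_append_take_cot (f : List Bool → Bool) (T : ℕ) (x : List Bool)
    {t : ℕ} (ht : t ≤ T) :
    (applyAppend f)^[t] x = x ++ (List.ofFn (cot f T x)).take t := by
  induction t with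
  | zero => simp
  | succ t ih =>
    rw [List.take_add_one, ← List.append_assoc, ← ih (by omega), Function.iterate_succ_apply',
      applyAppend]
    simp [Nat.lt_of_succ_le ht, cot_apply]

theorem apply_append_take_cot (f : List Bool → Bool) {T : ℕ} (x : List Bool) (t : Fin T) :
    f (x ++ (List.ofFn (cot f T x)).take t) = cot f T x t := by
  rw [← iterate_applyAppend_eq_append_take_cot f T x t.2.le, cot_apply]

end ChainOfThought

/-! ### Linear generators and the hard margin rule -/

section Linear

/-- Bit number `p` of `x` from the end, counted from `0`, as a real number, and `0` if `x` is too
short. -/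
def recentBit (x : List Bool) (p : ℕ) : ℝ := if x.reverse.getD p false then 1 else 0

theorem recentBit_of_length_le {x : List Bool} {p : ℕ} (h : x.length ≤ p) : recentBit x p = 0 := by
  rw [recentBit, List.getD_eq_default _ _ (by simpa using h)]
  simp

open Classical in
theorem linGenerator_eq {d : ℕ} (w : Fin d → ℝ) (b : ℝ) (x : List Bool) :
    linGenerator w b x = decide (0 ≤ (∑ p : Fin d, w p.rev * recentBit x p) + b) := by
  set g : ℕ → ℝ := fun p => if hp : p < d then w (Fin.rev ⟨p, hp⟩) * recentBit x p else 0 with hg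
  have h1 : (∑ i : Fin (min d x.length),
      w (Fin.rev (Fin.castLE (min_le_left d x.length) i)) *
        (if x.get (Fin.rev (Fin.castLE (min_le_right d x.length) i)) then (1 : ℝ) else 0)) =
      ∑ p ∈ Finset.range (min d x.length), g p := by
    rw [← Fin.sum_univ_eq_sum_range]
    refine Finset.sum_congr rfl fun i _ => ?_
    have hd : (i : ℕ) < d := i.2.trans_le (min_le_left _ _)
    have hx : (i : ℕ) < x.length := i.2.trans_le (min_le_right _ _)
    have hbit : x.reverse.getD i false =
        x.get (Fin.rev (Fin.castLE (min_le_right d x.length) i)) := by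
      rw [List.getD_eq_getElem _ _ (by simpa using hx), List.getElem_reverse]
      simp only [List.get_eq_getElem, Fin.val_rev, Fin.val_castLE]
      congr 1
      omega
    simp only [hg, hd, dif_pos, recentBit, hbit]
    rfl
  have h2 : (∑ p : Fin d, w p.rev * recentBit x p) = ∑ p ∈ Finset.range d, g p := by
    rw [← Fin.sum_univ_eq_sum_range]
    refine Finset.sum_congr rfl fun i _ => ?_
    simp [hg]
  have h3 : ∑ p ∈ Finset.range (min d x.length), g p = ∑ p ∈ Finset.range d, g p := by
    refine Finset.sum_subset (by simp) fun p hp hp' => ?_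
    simp only [Finset.mem_range, lt_min_iff, not_and, not_lt] at hp hp'
    simp [hg, recentBit_of_length_le (hp' hp)]
  rw [linGenerator, h1, h2, h3]

/-- The vector of the last `d` bits of `x`, with an additional entry `1` for the bias. -/
noncomputable def feature (d : ℕ) (x : List Bool) : EuclideanSpace ℝ (Option (Fin d)) :=
  WithLp.toLp 2 fun o => o.elim 1 fun p => recentBit x p

/-- The linear threshold generator with weights and bias collected in one vector. -/
noncomputable def vecGenerator {d : ℕ} (u : EuclideanSpace ℝ (Option (Fin d))) :
    List Bool → Bool :=
  linGenerator (fun i => u (some i.rev)) (u none)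

open Classical in
theorem vecGenerator_apply {d : ℕ} (u : EuclideanSpace ℝ (Option (Fin d))) (x : List Bool) :
    vecGenerator u x = decide (0 ≤ inner ℝ (feature d x) u) := by
  rw [vecGenerator, linGenerator_eq]
  simp [feature, PiLp.inner_apply, Fintype.sum_option, add_comm]

theorem exists_eq_vecGenerator {d : ℕ} {f : List Bool → Bool} (hf : f ∈ linClass d) :
    ∃ u : EuclideanSpace ℝ (Option (Fin d)), f = vecGenerator u := by
  obtain ⟨w, b, rfl⟩ := hf
  exact ⟨WithLp.toLp 2 fun o => o.elim b fun i => w i.rev, by simp [vecGenerator]⟩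

/-- The weight vectors that predict every symbol of the labeled example `(x, y)` with margin `1`. -/
def marginSet (d : ℕ) {T : ℕ} (x : List Bool) (y : Fin T → Bool) :
    Set (EuclideanSpace ℝ (Option (Fin d))) :=
  {u | ∀ t : Fin T,
    (y t = true → 1 ≤ inner ℝ (feature d (x ++ (List.ofFn y).take t)) u) ∧
    (y t = false → inner ℝ (feature d (x ++ (List.ofFn y).take t)) u ≤ -1)}

theorem convex_marginSet (d : ℕ) {T : ℕ} (x : List Bool) (y : Fin T → Bool) :
    Convex ℝ (marginSet d x y) := by
  intro u hu v hv a b ha hb hab t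
  rw [inner_add_right, inner_smul_right, inner_smul_right]
  refine ⟨fun h => ?_, fun h => ?_⟩
  · have h1 := mul_le_mul_of_nonneg_left ((hu t).1 h) ha
    have h2 := mul_le_mul_of_nonneg_left ((hv t).1 h) hb
    linarith
  · have h1 := mul_le_mul_of_nonneg_left ((hu t).2 h) ha
    have h2 := mul_le_mul_of_nonneg_left ((hv t).2 h) hb
    linarith

theorem isClosed_marginSet (d : ℕ) {T : ℕ} (x : List Bool) (y : Fin T → Bool) :
    IsClosed (marginSet d x y) := by
  simp only [marginSet, Set.ofPred_forall, Set.ofPred_and]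
  refine isClosed_iInter fun t => IsClosed.inter ?_ ?_
  · exact isClosed_iInter fun _ => isClosed_le (by fun_prop) (by fun_prop)
  · exact isClosed_iInter fun _ => isClosed_le (by fun_prop) (by fun_prop)

theorem cot_vecGenerator_eq {d T : ℕ} {x : List Bool} {y : Fin T → Bool}
    {u : EuclideanSpace ℝ (Option (Fin d))} (hu : u ∈ marginSet d x y) :
    cot (vecGenerator u) T x = y := by
  refine cot_eq_of_forall fun t => ?_
  rw [vecGenerator_apply]
  cases hy : y t
  · have := (hu t).2 hy
    simp only [decide_eq_false_iff_not, not_le]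
    linarith
  · have := (hu t).1 hy
    simp only [decide_eq_true_eq]
    linarith

/-- The target may attain the value `0` where it outputs `true`, so it need not have a margin. On
finitely many strings its negative values are at most `-2 * γ` for some `γ > 0`; raising the bias by
`γ` and scaling by `γ⁻¹` gives margin `1` on both sides. -/
theorem nonempty_iInter_marginSet {d : ℕ} (T : ℕ) {f : List Bool → Bool} (hf : f ∈ linClass d)
    {S : Set (List Bool)} (hS : S.Finite) :
    (⋂ x ∈ S, marginSet d x (cot f T x)).Nonempty := by
  obtain ⟨u, rfl⟩ := exists_eq_vecGenerator hf
  set s : List Bool → Fin T → List Bool := fun x t =>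
    x ++ (List.ofFn (cot (vecGenerator u) T x)).take t with hs
  have hev : ∀ᶠ γ : ℝ in nhdsWithin 0 (Set.Ioi 0), ∀ x ∈ S, ∀ t : Fin T,
      inner ℝ (feature d (s x t)) u < 0 → inner ℝ (feature d (s x t)) u + 2 * γ ≤ 0 := by
    refine (Filter.eventually_all_finite hS).2 fun x _ => Filter.eventually_all.2 fun t => ?_
    by_cases h : inner ℝ (feature d (s x t)) u < 0
    · have hlim : Filter.Tendsto (fun γ : ℝ => inner ℝ (feature d (s x t)) u + 2 * γ)
          (nhdsWithin 0 (Set.Ioi 0)) (nhds (inner ℝ (feature d (s x t)) u + 2 * 0)) :=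
        Filter.Tendsto.mono_left (Continuous.tendsto (by fun_prop) _) nhdsWithin_le_nhds
      filter_upwards [hlim.eventually_lt_const (by simpa using h)] with γ hγ _ using hγ.le
    · exact Filter.Eventually.of_forall fun _ h' => absurd h' h
  obtain ⟨γ, hγ, hγ0⟩ := (hev.and self_mem_nhdsWithin).exists
  have hγ0 : 0 < γ := hγ0
  have hbias : ∀ z, inner ℝ (feature d z)
      (γ⁻¹ • (u + γ • EuclideanSpace.single none (1 : ℝ))) =
      γ⁻¹ * inner ℝ (feature d z) u + 1 := by
    intro z
    rw [inner_smul_right, inner_add_right, inner_smul_right, EuclideanSpace.inner_single_right]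
    simp [feature]
    field_simp
  refine ⟨γ⁻¹ • (u + γ • EuclideanSpace.single none (1 : ℝ)), ?_⟩
  simp only [Set.mem_iInter]
  intro x hx t
  have happ := apply_append_take_cot (vecGenerator u) x t
  rw [vecGenerator_apply] at happ
  rw [hbias]
  refine ⟨fun h => ?_, fun h => ?_⟩
  · rw [h, decide_eq_true_eq] at happ
    have := mul_nonneg (inv_nonneg.2 hγ0.le) happ
    linarith
  · rw [h, decide_eq_false_iff_not, not_le] at happ
    have h1 := mul_le_mul_of_nonneg_left (hγ x hx t happ) (inv_nonneg.2 hγ0.le)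
    have h2 : γ⁻¹ * (2 * γ) = 2 := by field_simp
    rw [mul_add, h2] at h1
    simp only [hs] at h1
    linarith

/-- The hard margin rule: the weight vector of minimal norm with margin `1` on the sample. -/
noncomputable def marginRule (d T : ℕ) (L : List (List Bool × (Fin T → Bool))) :
    List Bool → (Fin T → Bool) :=
  cot (vecGenerator (minNormPoint (⋂ e ∈ L, marginSet d e.1 e.2))) T

theorem marginRule_labeledSample (d : ℕ) {T m : ℕ} (f : List Bool → (Fin T → Bool))
    (x : Fin m → List Bool) :
    marginRule d T (labeledSample f x) =
      cot (vecGenerator (minNormPoint (⋂ a ∈ Set.range x, marginSet d a (f a)))) T := by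
  have : (⋂ e ∈ labeledSample f x, marginSet d e.1 e.2) =
      ⋂ a ∈ Set.range x, marginSet d a (f a) := by
    ext u
    simp [labeledSample]
  rw [marginRule, this]

theorem measure_lt_loss_marginRule_le {d : ℕ} (T : ℕ) {f : List Bool → Bool}
    (hf : f ∈ linClass d) (μ : Measure (List Bool)) [IsProbabilityMeasure μ] {ε : ℝ} (hε : 0 ≤ ε)
    (m : ℕ) :
    Measure.pi (fun _ : Fin m => μ)
      {x | ENNReal.ofReal ε < loss μ (cot f T) (marginRule d T (labeledSample (cot f T) x))} ≤
      4 ^ (d + 1) * ENNReal.ofReal (1 - ε) ^ ((d + 1) * (m / (2 * (d + 1)))) := by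
  simp only [marginRule_labeledSample]
  refine measure_lt_loss_le_of_stable μ (cot f T)
    (fun S => cot (vecGenerator (minNormPoint (⋂ a ∈ S, marginSet d a (cot f T a)))) T)
    d.succ_pos (fun S hS x hx => ?_) (fun S hS => ?_) hε m
  · have h := (minNormPoint_spec (nonempty_iInter_marginSet T hf hS)
      (isClosed_biInter fun a _ => isClosed_marginSet d a _)).1
    simp only [Set.mem_iInter] at h
    exact cot_vecGenerator_eq (h x hx)
  · obtain ⟨K, hKS, hKc, hK⟩ := exists_minNormPoint_eq (fun a => marginSet d a (cot f T a))
      (fun a => convex_marginSet d a _) (fun a => isClosed_marginSet d a _) S hS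
      (nonempty_iInter_marginSet T hf hS)
    refine ⟨K, hKS, by simpa using hKc, fun S' h1 h2 => ?_⟩
    simp only [hK S' h1 h2]

end Linear

/-! ### Sample size for the upper bound -/

section UpperBound

/-- As `m ≥ 12 * d`, rounding in `q` leaves `(d + 1) * q ≥ m / 4`, so the exponent gains `3 * (d +
L)`. The factor `4 ^ (d + 1)` costs at most `1.4 * (d + 1) ≤ 2.8 * d`, which needs `d ≥ 1`. -/
theorem four_pow_mul_le {d m : ℕ} (hd : 1 ≤ d) {ε δ : ℝ} (hε : 0 < ε) (hε1 : ε < 1) (hδ : 0 < δ)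
    (hδ1 : δ < 1) (hm : 12 * (((d : ℝ) + Real.log (1 / δ)) / ε) ≤ m) :
    (4 : ℝ) ^ (d + 1) * (1 - ε) ^ ((d + 1) * (m / (2 * (d + 1)))) ≤ δ := by
  set q := m / (2 * (d + 1)) with hq
  set L := Real.log (1 / δ) with hL
  have hL0 : 0 ≤ L := Real.log_nonneg (by rw [le_div_iff₀ hδ]; linarith)
  have hd' : (1 : ℝ) ≤ d := by exact_mod_cast hd
  have hm1 : 12 * ((d : ℝ) + L) ≤ ε * m := by
    have := mul_le_mul_of_nonneg_left hm hε.le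
    field_simp at this
    linarith
  have hεm : ε * m ≤ m := mul_le_of_le_one_left (Nat.cast_nonneg m) hε1.le
  have hqm : (m : ℝ) ≤ 2 * (d + 1) * (q + 1) := by
    have := (Nat.lt_mul_div_succ m (show 0 < 2 * (d + 1) by omega)).le
    rw [← hq] at this
    exact_mod_cast this
  have hkq : (m : ℝ) / 4 ≤ (d + 1) * q := by nlinarith
  have hexp : 3 * ((d : ℝ) + L) ≤ ε * ((d + 1) * q) := by
    have := mul_le_mul_of_nonneg_left hkq hε.le
    linarith
  have h4 : (4 : ℝ) ^ (d + 1) = Real.exp ((d + 1) * Real.log 4) := by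
    rw [← Real.log_rpow (by norm_num), Real.exp_log (by positivity)]
    exact_mod_cast rfl
  have hlog4 : Real.log 4 ≤ 1.4 := by
    have : Real.log 4 = 2 * Real.log 2 := by
      rw [show (4 : ℝ) = 2 ^ 2 by norm_num, Real.log_pow]; norm_num
    have := Real.log_two_lt_d9
    linarith
  have hδL : δ = Real.exp (-L) := by
    rw [hL, one_div, Real.log_inv, neg_neg, Real.exp_log hδ]
  calc _ ≤ Real.exp ((d + 1) * Real.log 4) * Real.exp (-ε) ^ ((d + 1) * q) := by
        rw [h4]
        have h1 : 0 ≤ 1 - ε := by linarith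
        gcongr
        exact Real.one_sub_le_exp_neg ε
    _ = Real.exp ((d + 1) * Real.log 4 - ε * ((d + 1) * q)) := by
        rw [← Real.exp_nat_mul, ← Real.exp_add]
        congr 1
        push_cast
        ring
    _ ≤ δ := by
        rw [hδL]
        refine Real.exp_le_exp.2 ?_
        nlinarith

theorem loss_le_one {X Y : Type*} [MeasurableSpace X] (μ : Measure X) [IsProbabilityMeasure μ]
    (f h : X → Y) : loss μ f h ≤ 1 := prob_le_one

/-- The rule that predicts the first label of the sample everywhere. -/
def firstLabelRule {X Y : Type*} (y₀ : Y) (L : List (X × Y)) : X → Y :=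
  fun _ => (L.head?.map Prod.snd).getD y₀

theorem firstLabelRule_labeledSample {X Y : Type*} (y₀ y : Y) {m : ℕ} (hm : 0 < m) (x : Fin m → X) :
    firstLabelRule y₀ (labeledSample (fun _ => y) x) = fun _ => y := by
  obtain ⟨n, rfl⟩ : ∃ n, m = n + 1 := ⟨m - 1, by omega⟩
  funext z
  simp [firstLabelRule, labeledSample, List.ofFn_succ]

theorem exists_cot_eq_const {T : ℕ} {f : List Bool → Bool} (hf : f ∈ linClass 0) :
    ∃ y, cot f T = fun _ => y := by
  obtain ⟨w, b, rfl⟩ := hf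
  refine ⟨cot (linGenerator w b) T [], ?_⟩
  funext x t
  simp [cot_apply, linGenerator_eq]

theorem learnableWith_cotClass_linClass (d T : ℕ) :
    LearnableWith (cotClass (linClass d) T)
      (fun ε δ => ⌈12 * (((d : ℝ) + Real.log (1 / δ)) / ε)⌉₊) := by
  suffices h : ∃ lrn : List (List Bool × (Fin T → Bool)) → (List Bool → (Fin T → Bool)),
      ∀ (D : Measure (List Bool)) [IsProbabilityMeasure D] (ε δ : ℝ), 0 < ε → 0 < δ →
        ε < 1 → δ < 1 → ∀ f ∈ linClass d, ∀ m : ℕ,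
        12 * (((d : ℝ) + Real.log (1 / δ)) / ε) ≤ m →
        Measure.pi (fun _ : Fin m => D)
          {x | ENNReal.ofReal ε < loss D (cot f T) (lrn (labeledSample (cot f T) x))} ≤
            ENNReal.ofReal δ by
    obtain ⟨lrn, h⟩ := h
    refine ⟨lrn, fun D _ ε δ hε hδ g hg => ?_⟩
    obtain ⟨f, hf, rfl⟩ := hg
    by_cases hδ1 : 1 ≤ δ
    · refine prob_le_one.trans ?_
      rw [← ENNReal.ofReal_one]
      exact ENNReal.ofReal_le_ofReal hδ1
    by_cases hε1 : 1 ≤ ε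
    · have hempty : ∀ l : List Bool → (Fin T → Bool),
          ¬ ENNReal.ofReal ε < loss D (cot f T) l := fun l => by
        rw [not_lt]
        refine (loss_le_one D _ l).trans ?_
        rw [← ENNReal.ofReal_one]
        exact ENNReal.ofReal_le_ofReal hε1
      simp [hempty]
    exact h D ε δ hε hδ (not_le.1 hε1) (not_le.1 hδ1) f hf _ (Nat.le_ceil _)
  rcases Nat.eq_zero_or_pos d with rfl | hd
  -- For `d = 0` and `δ` near `1` the sample size is too small to absorb the factor `4`. But all
  -- targets are constant, so one example suffices, and `δ < 1` guarantees one.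
  · refine ⟨firstLabelRule fun _ => false, fun D _ ε δ hε hδ _ hδ1 f hf m hm => ?_⟩
    have hm0 : 0 < m := by
      have hL : 0 < Real.log (1 / δ) := Real.log_pos (by rw [lt_div_iff₀ hδ]; linarith)
      have : (0 : ℝ) < m := lt_of_lt_of_le (by positivity) hm
      exact_mod_cast this
    obtain ⟨y, hy⟩ := exists_cot_eq_const (T := T) hf
    simp [hy, firstLabelRule_labeledSample _ _ hm0, loss]
  · refine ⟨marginRule d T, fun D _ ε δ hε hδ hε1 hδ1 f hf m hm => ?_⟩
    refine (measure_lt_loss_marginRule_le T hf D hε.le m).trans ?_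
    have h := ENNReal.ofReal_le_ofReal (four_pow_mul_le hd hε hε1 hδ hδ1 hm)
    rwa [ENNReal.ofReal_mul (by positivity), ENNReal.ofReal_pow (by norm_num),
      ENNReal.ofReal_pow (by linarith), ENNReal.ofReal_ofNat] at h

end UpperBound

/-! ### Lower bounds for abstract classes -/

section LowerBound

theorem labeledSample_congr {X Y : Type*} {f g : X → Y} {m : ℕ} {x : Fin m → X} (h : ∀ j, f (x j) = g (x j)) :
    labeledSample f x = labeledSample g x := by
  simp [labeledSample, h]

/-- Among the sign patterns that differ only at `i`, a predictor that does not see coordinate `i`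
errs on half. -/
theorem two_pow_le_two_mul_sum_indicator {Y : Type*} {N : ℕ} (i : Fin N) (g : Bool → Y)
    (hg : g false ≠ g true) (pred : (Fin N → Bool) → Y)
    (hpred : ∀ σ, pred (Function.update σ i (!σ i)) = pred σ) [DecidableEq Y] :
    (2 : ENNReal) ^ N ≤ 2 * ∑ σ, if pred σ ≠ g (σ i) then (1 : ENNReal) else 0 := by
  set flip : (Fin N → Bool) → (Fin N → Bool) := fun σ => Function.update σ i (!σ i) with hflip
  have hinv : Function.Involutive flip := fun σ => by
    simp [hflip]
  have hsum : ∑ σ, (if pred σ ≠ g (σ i) then (1 : ENNReal) else 0) =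
      ∑ σ, if pred σ ≠ g (!σ i) then (1 : ENNReal) else 0 := by
    rw [← Equiv.sum_comp hinv.toPerm]
    refine Finset.sum_congr rfl fun σ _ => ?_
    simp [hflip, hpred]
  rw [two_mul]
  nth_rewrite 2 [hsum]
  rw [← Finset.sum_add_distrib]
  calc (2 : ENNReal) ^ N = ∑ _σ : Fin N → Bool, (1 : ENNReal) := by simp
    _ ≤ _ := by
      refine Finset.sum_le_sum fun σ _ => ?_
      by_cases h : pred σ = g (σ i)
      · have h' : pred σ ≠ g (!σ i) := by
          rw [h]
          cases σ i
          · simpa using hg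
          · simpa using hg.symm
        simp [h']
      · simp [h]

variable {X Y : Type*} [MeasurableSpace X]

/-- Two targets that agree at one point and differ at another force `Ω(log (1 / δ) / ε)`
examples. -/
theorem LearnableWith.log_le [DiscreteMeasurableSpace X] {H : Set (X → Y)} {m : ℝ → ℝ → ℕ}
    (hH : LearnableWith H m)
    {x₀ x₁ : X} {h₀ h₁ : X → Y} (hh₀ : h₀ ∈ H) (hh₁ : h₁ ∈ H) (hx₀ : h₀ x₀ = h₁ x₀)
    (hx₁ : h₀ x₁ ≠ h₁ x₁) {ε δ : ℝ} (hε : 0 < ε) (hε' : ε ≤ 1 / 8) (hδ : 0 < δ) :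
    Real.log (1 / δ) ≤ 4 * ε * m ε δ := by
  classical
  obtain ⟨lrn, hlrn⟩ := hH
  set M := m ε δ with hM
  set D : Measure X := ENNReal.ofReal (1 - 2 * ε) • Measure.dirac x₀ +
    ENNReal.ofReal (2 * ε) • Measure.dirac x₁ with hD
  have : IsProbabilityMeasure D := ⟨by
    simp only [hD, Measure.add_apply, Measure.smul_apply, measure_univ, smul_eq_mul, mul_one]
    rw [← ENNReal.ofReal_add (by linarith) (by linarith)]
    simp⟩
  have hD0 : ENNReal.ofReal (1 - 2 * ε) ≤ D {x₀} := by
    simp [hD]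
  have hD1 : ∀ s : Set X, x₁ ∈ s → ENNReal.ofReal ε < D s := fun s hs => by
    have h1 : ENNReal.ofReal (2 * ε) ≤ D s := by
      simp [hD, Measure.dirac_apply' _ (MeasurableSet.of_discrete (s := s)), hs]
    exact lt_of_lt_of_le ((ENNReal.ofReal_lt_ofReal_iff (by linarith)).2 (by linarith)) h1
  have hsample : labeledSample h₀ (fun _ : Fin M => x₀) = labeledSample h₁ fun _ : Fin M => x₀ :=
    labeledSample_congr fun _ => hx₀
  have hconst : ENNReal.ofReal (1 - 2 * ε) ^ M ≤ Measure.pi (fun _ : Fin M => D) {fun _ => x₀} := by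
    rw [← Set.univ_pi_singleton, Measure.pi_pi]
    simpa using pow_le_pow_left' hD0 M
  -- On the sample that is constantly `x₀` the rule cannot tell the targets apart, so at `x₁`, which
  -- has mass `2 * ε`, it fails for one of them.
  have hkey : ENNReal.ofReal (1 - 2 * ε) ^ M ≤ ENNReal.ofReal δ := by
    refine hconst.trans ?_
    by_cases hl : lrn (labeledSample h₀ fun _ : Fin M => x₀) x₁ = h₀ x₁
    · refine le_trans (measure_mono ?_) (hlrn D ε δ hε hδ h₁ hh₁)
      rw [Set.singleton_subset_iff]
      refine hD1 _ ?_
      rw [Set.mem_ofPred_eq, ← hsample, hl]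
      exact hx₁
    · refine le_trans (measure_mono ?_) (hlrn D ε δ hε hδ h₀ hh₀)
      rw [Set.singleton_subset_iff]
      exact hD1 _ hl
  rw [← ENNReal.ofReal_pow (by linarith), ENNReal.ofReal_le_ofReal_iff hδ.le] at hkey
  have h1 := Real.log_le_log (pow_pos (by linarith) M) hkey
  rw [Real.log_pow] at h1
  have h2 : -(4 * ε) ≤ Real.log (1 - 2 * ε) := by
    refine le_trans ?_ (Real.one_sub_inv_le_log_of_pos (by linarith))
    have : (1 - 2 * ε)⁻¹ ≤ 1 + 4 * ε := by
      rw [inv_le_iff_one_le_mul₀ (by linarith)]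
      nlinarith
    linarith
  rw [one_div, Real.log_inv]
  have h3 := mul_le_mul_of_nonneg_left h2 (Nat.cast_nonneg (α := ℝ) M)
  linarith

/-- A family of targets that shatters `N` points, while all its members agree at one further point,
forces `Ω(N / ε)` examples. -/
theorem LearnableWith.card_le [DiscreteMeasurableSpace X] [Countable X] {H : Set (X → Y)}
    {m : ℝ → ℝ → ℕ} (hH : LearnableWith H m) {N : ℕ} {x : Fin N → X} (hx : Function.Injective x)
    {x₀ : X} (hx₀ : ∀ i, x i ≠ x₀) {h : (Fin N → Bool) → X → Y} (hh : ∀ σ, h σ ∈ H) {y₀ : Y}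
    (hy₀ : ∀ σ, h σ x₀ = y₀) {g : Fin N → Bool → Y} (hg : ∀ i, g i false ≠ g i true)
    (hhg : ∀ σ i, h σ (x i) = g i (σ i)) {ε δ : ℝ} (hε : 0 < ε) (hε' : ε ≤ 1 / 8) (hδ : 0 < δ)
    (hδ' : δ ≤ 1 / 8) :
    (N : ℝ) ≤ 16 * ε * m ε δ := by
  classical
  rcases Nat.eq_zero_or_pos N with rfl | hN
  · simp only [Nat.cast_zero]
    positivity
  obtain ⟨lrn, hlrn⟩ := hH
  set M := m ε δ with hM
  have hN' : (1 : ℝ) ≤ N := by exact_mod_cast hN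
  -- The shattered points share mass `4 * ε`. A learner may err on mass at most `ε + 4 * ε / 8 = 3 /
  -- 2 * ε` on average, while guessing on every unseen point costs `2 * ε * (1 - p) ^ M`. Hence `(1
  -- - p) ^ M ≤ 3 / 4`.
  set p : ℝ := 4 * ε / N with hp
  have hp0 : 0 < p := by positivity
  have hNp : N * p = 4 * ε := by rw [hp]; field_simp
  have hp1 : p ≤ 1 / 2 := by nlinarith
  set D : Measure X := ENNReal.ofReal (1 - 4 * ε) • Measure.dirac x₀ +
    ∑ i, ENNReal.ofReal p • Measure.dirac (x i) with hD
  have hDapp : ∀ s : Set X, D s = ENNReal.ofReal (1 - 4 * ε) * s.indicator 1 x₀ +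
      ∑ i, ENNReal.ofReal p * s.indicator 1 (x i) := fun s => by
    simp [hD, Measure.dirac_apply' _ (MeasurableSet.of_discrete (s := s))]
  have hprob : IsProbabilityMeasure D := ⟨by
    rw [hDapp]
    simp only [Set.indicator_univ, Pi.one_apply, mul_one, Finset.sum_const, Finset.card_univ, Fintype.card_fin,
      nsmul_eq_mul]
    rw [← ENNReal.ofReal_natCast, ← ENNReal.ofReal_mul (by positivity),
      ← ENNReal.ofReal_add (by linarith) (by positivity), hNp]
    simp⟩
  set P := Measure.pi (fun _ : Fin M => D) with hP
  set ind : (Fin N → Bool) → Fin N → (Fin M → X) → ENNReal := fun σ i z =>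
    if lrn (labeledSample (h σ) z) (x i) ≠ g i (σ i) then 1 else 0 with hind
  -- the expected number of mistakes for a single target
  have hupper : ∀ σ, ∑ i, ENNReal.ofReal p * ∫⁻ z, ind σ i z ∂P ≤ ENNReal.ofReal (3 / 2 * ε) := by
    intro σ
    set B : Set (Fin M → X) := {z | ENNReal.ofReal ε < loss D (h σ) (lrn (labeledSample (h σ) z))}
      with hB
    have hBP : P B ≤ ENNReal.ofReal (1 / 8) :=
      (hlrn D ε δ hε hδ (h σ) (hh σ)).trans (ENNReal.ofReal_le_ofReal hδ')
    have hpt : ∀ z, ∑ i, ENNReal.ofReal p * ind σ i z ≤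
        ENNReal.ofReal ε + B.indicator (fun _ => ENNReal.ofReal (4 * ε)) z := by
      intro z
      by_cases hz : z ∈ B
      · rw [Set.indicator_of_mem hz]
        refine le_add_left ?_
        calc _ ≤ ∑ _i : Fin N, ENNReal.ofReal p := by
              refine Finset.sum_le_sum fun i _ => ?_
              simp only [hind]
              split_ifs <;> simp
          _ = _ := by
              rw [Finset.sum_const, Finset.card_univ, Fintype.card_fin, nsmul_eq_mul,
                ← ENNReal.ofReal_natCast, ← ENNReal.ofReal_mul (by positivity), hNp]
      · rw [Set.indicator_of_notMem hz, add_zero]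
        refine le_trans ?_ (not_lt.1 hz)
        rw [loss, hDapp]
        refine le_add_left (le_of_eq ?_)
        simp [hind, hhg, Set.indicator_apply]
    calc _ = ∫⁻ z, ∑ i, ENNReal.ofReal p * ind σ i z ∂P := by
          rw [lintegral_finsetSum _ fun _ _ => Measurable.of_discrete]
          exact Finset.sum_congr rfl fun i _ => (lintegral_const_mul _ Measurable.of_discrete).symm
      _ ≤ ∫⁻ z, ENNReal.ofReal ε + B.indicator (fun _ => ENNReal.ofReal (4 * ε)) z ∂P :=
          lintegral_mono hpt
      _ = ENNReal.ofReal ε + ENNReal.ofReal (4 * ε) * P B := by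
          rw [lintegral_add_left measurable_const, lintegral_indicator_const MeasurableSet.of_discrete]
          simp
      _ ≤ ENNReal.ofReal ε + ENNReal.ofReal (4 * ε) * ENNReal.ofReal (1 / 8) := by gcongr
      _ = _ := by
          rw [← ENNReal.ofReal_mul (by positivity), ← ENNReal.ofReal_add hε.le (by positivity)]
          congr 1
          ring
  -- the expected number of mistakes at one point for a random target
  have hlower : ∀ i, (2 : ENNReal) ^ N * ENNReal.ofReal (1 - p) ^ M ≤
      2 * ∑ σ, ∫⁻ z, ind σ i z ∂P := by
    intro i
    -- Samples inside `G` miss `x i`, so their labels do not depend on `σ i`.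
    set G : Set X := {a | a = x₀ ∨ ∃ j, j ≠ i ∧ a = x j} with hG
    set Ω : Set (Fin M → X) := Set.univ.pi fun _ => G with hΩ
    have hGD : ENNReal.ofReal (1 - p) ≤ D G := by
      have h0 : x₀ ∈ G := Or.inl rfl
      have hj : ∀ j, x j ∈ G ↔ j ≠ i := fun j => by
        simp only [hG, Set.mem_ofPred_eq, hx₀, false_or]
        constructor
        · rintro ⟨k, hk, hjk⟩
          rwa [hx hjk]
        · exact fun hji => ⟨j, hji, rfl⟩
      have hsum : ∑ j, ENNReal.ofReal p * G.indicator 1 (x j) =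
          ENNReal.ofReal ((N - 1) * p) := by
        simp only [Set.indicator_apply, hj, Pi.one_apply, mul_ite, mul_one, mul_zero]
        rw [← Finset.sum_filter, Finset.sum_const, Finset.filter_ne', Finset.card_erase_of_mem
          (Finset.mem_univ _), Finset.card_univ, Fintype.card_fin, nsmul_eq_mul,
          ← ENNReal.ofReal_natCast, ← ENNReal.ofReal_mul (by positivity), Nat.cast_sub hN]
        simp
      rw [hDapp, hsum, Set.indicator_of_mem h0, Pi.one_apply, mul_one, ← ENNReal.ofReal_add (by linarith)
        (mul_nonneg (by linarith) hp0.le)]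
      refine ENNReal.ofReal_le_ofReal ?_
      linarith
    have hΩP : ENNReal.ofReal (1 - p) ^ M ≤ P Ω := by
      rw [hP, hΩ, Measure.pi_pi]
      simpa using pow_le_pow_left' hGD M
    have hpt : ∀ z, Ω.indicator (fun _ => (2 : ENNReal) ^ N) z ≤ 2 * ∑ σ, ind σ i z := by
      intro z
      by_cases hz : z ∈ Ω
      · rw [Set.indicator_of_mem hz]
        refine two_pow_le_two_mul_sum_indicator i (g i) (hg i)
          (fun σ => lrn (labeledSample (h σ) z) (x i)) fun σ => ?_
        have : labeledSample (h (Function.update σ i (!σ i))) z = labeledSample (h σ) z := by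
          refine labeledSample_congr fun j => ?_
          rcases hz j (Set.mem_univ j) with hj | ⟨k, hk, hj⟩
          · rw [hj, hy₀, hy₀]
          · rw [hj, hhg, hhg, Function.update_of_ne hk]
        simp only [this]
      · simp [Set.indicator_of_notMem hz]
    calc _ ≤ (2 : ENNReal) ^ N * P Ω := by gcongr
      _ = ∫⁻ z, Ω.indicator (fun _ => (2 : ENNReal) ^ N) z ∂P := by
          rw [lintegral_indicator_const MeasurableSet.of_discrete]
      _ ≤ ∫⁻ z, 2 * ∑ σ, ind σ i z ∂P := lintegral_mono hpt
      _ = _ := by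
          rw [lintegral_const_mul _ Measurable.of_discrete,
            lintegral_finsetSum _ fun _ _ => Measurable.of_discrete]
  have hcomb : (N : ENNReal) * ENNReal.ofReal p * ((2 : ENNReal) ^ N * ENNReal.ofReal (1 - p) ^ M) ≤
      2 * (2 ^ N * ENNReal.ofReal (3 / 2 * ε)) := by
    calc _ = ∑ _i : Fin N, ENNReal.ofReal p * ((2 : ENNReal) ^ N * ENNReal.ofReal (1 - p) ^ M) := by
          rw [Finset.sum_const, Finset.card_univ, Fintype.card_fin, nsmul_eq_mul, mul_assoc]
      _ ≤ ∑ i : Fin N, ENNReal.ofReal p * (2 * ∑ σ, ∫⁻ z, ind σ i z ∂P) := by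
          exact Finset.sum_le_sum fun i _ => mul_le_mul' le_rfl (hlower i)
      _ = 2 * ∑ σ, ∑ i, ENNReal.ofReal p * ∫⁻ z, ind σ i z ∂P := by
          rw [Finset.sum_comm, Finset.mul_sum]
          refine Finset.sum_congr rfl fun i _ => ?_
          rw [← Finset.mul_sum]
          ring
      _ ≤ 2 * ∑ _σ : Fin N → Bool, ENNReal.ofReal (3 / 2 * ε) := by
          gcongr
          exact hupper _
      _ = _ := by simp
  have hreal : (N : ℝ) * p * (2 ^ N * (1 - p) ^ M) ≤ 2 * (2 ^ N * (3 / 2 * ε)) := by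
    rw [← ENNReal.ofReal_le_ofReal_iff (by positivity), ENNReal.ofReal_mul (by positivity),
      ENNReal.ofReal_mul (by positivity), ENNReal.ofReal_mul (by positivity),
      ENNReal.ofReal_mul (by positivity), ENNReal.ofReal_mul (by positivity),
      ENNReal.ofReal_pow (by positivity), ENNReal.ofReal_pow (by linarith), ENNReal.ofReal_natCast,
      ENNReal.ofReal_ofNat]
    exact hcomb
  have h34 : (1 - p) ^ M ≤ 3 / 4 := by
    rw [hNp] at hreal
    have h2 : (0 : ℝ) < 4 * ε * 2 ^ N := by positivity
    refine le_of_mul_le_mul_left ?_ h2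
    linarith
  -- Bernoulli: `1 - M * p ≤ 3 / 4`, that is `M * p ≥ 1 / 4`; with `N * p = 4 * ε` this is the
  -- claim.
  have hbern := one_add_mul_le_pow (a := -p) (by linarith) M
  have hMp : 1 / 4 ≤ M * p := by
    rw [← sub_eq_add_neg] at hbern
    linarith
  have : (N : ℝ) * (1 / 4) ≤ N * (M * p) := by gcongr
  nlinarith

end LowerBound

/-! ### Disjunctions as linear generators -/

section Disjunction

open Classical in
/-- The disjunction of the bits in the positions `A` among the last `d` bits, where positions are
counted from the end. -/
noncomputable def orGenerator (d : ℕ) (A : Set ℕ) (x : List Bool) : Bool :=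
  decide (∃ p < d, p ∈ A ∧ x.reverse.getD p false = true)

theorem orGenerator_eq_true_iff {d : ℕ} {A : Set ℕ} {x : List Bool} :
    orGenerator d A x = true ↔ ∃ p < d, p ∈ A ∧ x.reverse.getD p false = true := by
  classical
  unfold orGenerator
  exact decide_eq_true_iff

/-- Weight `1` on the positions in `A` and threshold `1 / 2`. -/
theorem orGenerator_mem_linClass (d : ℕ) (A : Set ℕ) : orGenerator d A ∈ linClass d := by
  classical
  refine ⟨fun i => if (i.rev : ℕ) ∈ A then 1 else 0, -(1 / 2), ?_⟩
  funext x
  rw [linGenerator_eq, orGenerator, decide_eq_decide]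
  simp only [Fin.rev_rev]
  have hnn : ∀ p : Fin d, 0 ≤ (if (p : ℕ) ∈ A then (1 : ℝ) else 0) * recentBit x p := fun p => by
    rw [recentBit]
    split_ifs <;> simp
  constructor
  · rintro ⟨p, hp, hA, hb⟩
    have := Finset.single_le_sum (fun q _ => hnn q) (Finset.mem_univ (⟨p, hp⟩ : Fin d))
    simp only [hA, if_true, recentBit, hb] at this
    simp only [recentBit]
    linarith
  · intro h
    by_contra hcon
    push Not at hcon
    have h0 : ∑ p : Fin d, (if (p : ℕ) ∈ A then (1 : ℝ) else 0) * recentBit x p = 0 := by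
      refine Finset.sum_eq_zero fun p _ => ?_
      by_cases hA : (p : ℕ) ∈ A
      · rw [recentBit, if_neg (hcon p p.2 hA), mul_zero]
      · simp [hA]
    rw [h0] at h
    norm_num at h

theorem orGenerator_append_true {d : ℕ} {A : Set ℕ} (hd : 0 < d) (hA : 0 ∈ A) (x : List Bool) :
    orGenerator d A (x ++ [true]) = true := by
  rw [orGenerator_eq_true_iff]
  exact ⟨0, hd, hA, by simp⟩

theorem cot_orGenerator_nil (d T : ℕ) (A : Set ℕ) :
    cot (orGenerator d A) T [] = fun _ => false := by
  refine cot_eq_of_forall fun t => ?_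
  rw [Bool.eq_false_iff, ne_eq, orGenerator_eq_true_iff]
  rintro ⟨p, -, -, h⟩
  simp only [List.nil_append, List.ofFn_const, List.take_replicate, List.reverse_replicate,
    List.getD_eq_getElem?_getD, List.getElem?_replicate] at h
  split_ifs at h <;> simp at h

/-- The string whose only `true` bit is followed by `n` bits `false`. -/
def pointString (n : ℕ) : List Bool := true :: List.replicate n false

theorem orGenerator_pointString {d n : ℕ} (A : Set ℕ) [Decidable (n ∈ A)] (hn : n < d) :
    orGenerator d A (pointString n) = decide (n ∈ A) := by
  rw [Bool.eq_iff_iff, orGenerator_eq_true_iff, decide_eq_true_iff]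
  have hbit : ∀ p, (pointString n).reverse.getD p false = true ↔ p = n := fun p => by
    rw [pointString, List.reverse_cons, List.reverse_replicate]
    rcases lt_trichotomy p n with hp | rfl | hp
    · rw [List.getD_append _ _ _ _ (by simpa using hp)]
      simp [hp, hp.ne]
    · simp
    · rw [List.getD_eq_default _ _ (by simpa using hp)]
      simp [hp.ne']
  simp only [hbit]
  constructor
  · rintro ⟨p, -, hA, rfl⟩
    exact hA
  · exact fun hA => ⟨n, hn, hA, rfl⟩

theorem orGenerator_pointString_append {d n : ℕ} {A : Set ℕ} (hn : n + 1 < d) (hA : n + 1 ∈ A)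
    (b : Bool) : orGenerator d A (pointString n ++ [b]) = true := by
  rw [orGenerator_eq_true_iff]
  exact ⟨n + 1, hn, hA, by simp [pointString]⟩

/-- After the first token the `true` bit has moved to position `n + 1`, which forces `true`; from
then on the last bit, at position `0`, keeps the output `true`. So only the first token reveals
anything about `A`. -/
theorem cot_orGenerator_pointString {d n T : ℕ} {A : Set ℕ} [Decidable (n ∈ A)] (hn : n + 1 < d)
    (hA : n + 1 ∈ A) (h0 : 0 ∈ A) :
    cot (orGenerator d A) T (pointString n) =
      fun t : Fin T => if (t : ℕ) = 0 then decide (n ∈ A) else true := by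
  have key : ∀ t, orGenerator d A ((applyAppend (orGenerator d A))^[t + 1] (pointString n)) =
      true := by
    intro t
    induction t with
    | zero => exact orGenerator_pointString_append hn hA _
    | succ t ih =>
      rw [Function.iterate_succ_apply', applyAppend, ih]
      exact orGenerator_append_true (by omega) h0 _
  funext t
  rw [cot_apply]
  obtain ⟨_ | t, ht⟩ := t
  · simpa using orGenerator_pointString A (by omega)
  · simpa using key t

end Disjunction

/-! ### Lower bounds for linear generators and conclusion -/

section Main

theorem pointString_injective : Function.Injective pointString := fun a b h => by
  simpa [pointString] using congrArg List.length h

theorem LearnableWith.log_le_of_linClass {d T : ℕ} (hd : 1 ≤ d) (hT : 1 ≤ T) {m : ℝ → ℝ → ℕ}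
    (hm : LearnableWith (cotClass (linClass d) T) m) {ε δ : ℝ} (hε : 0 < ε) (hε' : ε ≤ 1 / 8)
    (hδ : 0 < δ) : Real.log (1 / δ) ≤ 4 * ε * m ε δ := by
  classical
  refine hm.log_le (x₀ := []) (x₁ := pointString 0)
    ⟨_, orGenerator_mem_linClass d ∅, rfl⟩ ⟨_, orGenerator_mem_linClass d {0}, rfl⟩ ?_ ?_ hε hε' hδ
  · rw [cot_orGenerator_nil, cot_orGenerator_nil]
  · intro h
    have h0 := congrFun h ⟨0, hT⟩
    simp [cot_apply, orGenerator_pointString _ (show 0 < d from hd)] at h0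

theorem LearnableWith.dim_le_of_linClass {d T : ℕ} (hT : 1 ≤ T) {m : ℝ → ℝ → ℕ}
    (hm : LearnableWith (cotClass (linClass d) T) m) {ε δ : ℝ} (hε : 0 < ε) (hε' : ε ≤ 1 / 8)
    (hδ : 0 < δ) (hδ' : δ ≤ 1 / 8) : (((d - 1) / 2 : ℕ) : ℝ) ≤ 16 * ε * m ε δ := by
  classical
  -- Odd positions encode `σ`; all even ones belong to `A σ`, so that `0` and the successor `2 * i +
  -- 2` of each odd position do. The bound `i < (d - 1) / 2` keeps `2 * i + 2` below `d`.
  set A : (Fin ((d - 1) / 2) → Bool) → Set ℕ := fun σ =>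
    {p | Even p ∨ ∃ i : Fin ((d - 1) / 2), p = 2 * (i : ℕ) + 1 ∧ σ i = true} with hA
  have hmem : ∀ σ (i : Fin ((d - 1) / 2)), 2 * (i : ℕ) + 1 ∈ A σ ↔ σ i = true := fun σ i => by
    have hodd : ¬ Even (2 * (i : ℕ) + 1) := by simp
    simp only [hA, Set.mem_ofPred_eq, hodd, false_or]
    constructor
    · rintro ⟨j, hj, hσ⟩
      rwa [show i = j by ext; omega]
    · exact fun hσ => ⟨i, rfl, hσ⟩
  refine hm.card_le (x := fun i : Fin ((d - 1) / 2) => pointString (2 * i + 1)) (x₀ := [])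
    (h := fun σ => cot (orGenerator d (A σ)) T) (y₀ := fun _ => false)
    (g := fun _ b (t : Fin T) => if (t : ℕ) = 0 then b else true) (fun i j hij => ?_)
    (fun i => by simp [pointString]) (fun σ => ⟨_, orGenerator_mem_linClass d (A σ), rfl⟩)
    (fun σ => cot_orGenerator_nil d T _) (fun i h => ?_) (fun σ i => ?_) hε hε' hδ hδ'
  · have := pointString_injective hij
    ext
    omega
  · simpa using congrFun h ⟨0, hT⟩
  · have hi := i.2
    rw [cot_orGenerator_pointString (by omega) (Or.inl (by simp [parity_simps]))
      (Or.inl (by simp))]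
    funext t
    simp [hmem]

end Main

end Autoregressive

theorem mainTheorem7 :
    (∃ C : ℝ, 0 < C ∧ ∀ d T : ℕ,
      Autoregressive.LearnableWith
        (Autoregressive.cotClass (Autoregressive.linClass d) T)
        (fun ε δ => ⌈C * (((d : ℝ) + Real.log (1 / δ)) / ε)⌉₊)) ∧
    (∃ c : ℝ, 0 < c ∧ ∀ d T : ℕ, 1 ≤ d → 1 ≤ T → ∀ m : ℝ → ℝ → ℕ,
      Autoregressive.LearnableWith
        (Autoregressive.cotClass (Autoregressive.linClass d) T) m →
      ∀ ε δ : ℝ, 0 < ε → ε ≤ 1 / 8 → 0 < δ → δ ≤ 1 / 8 →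
        c * (((d : ℝ) + Real.log (1 / δ)) / ε) ≤ (m ε δ : ℝ)) := by
  refine ⟨⟨12, by norm_num, Autoregressive.learnableWith_cotClass_linClass⟩,
    ⟨1 / 40, by norm_num, fun d T hd hT m hm ε δ hε hε' hδ hδ' => ?_⟩⟩
  have h1 := hm.log_le_of_linClass hd hT hε hε' hδ
  have h2 := hm.dim_le_of_linClass hT hε hε' hδ hδ'
  have h3 : (d : ℝ) ≤ 2 * (((d - 1) / 2 : ℕ) : ℝ) + 2 := by
    have : d ≤ 2 * ((d - 1) / 2) + 2 := by omega
    exact_mod_cast this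
  -- This absorbs the rounding term `2` in `h3`: `d ≤ 32 * ε * m + 2 ≤ 36 * ε * m`, and adding `log
  -- (1 / δ) ≤ 4 * ε * m` gives the constant `40`.
  have h4 : 2 ≤ Real.log (1 / δ) := by
    have h8 : Real.log 8 ≤ Real.log (1 / δ) := by
      refine Real.log_le_log (by norm_num) ?_
      rw [le_div_iff₀ hδ]
      linarith
    have : Real.log 8 = 3 * Real.log 2 := by
      rw [show (8 : ℝ) = 2 ^ 3 by norm_num, Real.log_pow]
      norm_num
    have := Real.log_two_gt_d9
    linarith
  rw [mul_div_assoc', div_le_iff₀ hε]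
  linarith
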